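/- Let $\sigma_1,\sigma_2,\sigma_3$ be the Pauli matrices and $\sigma_0=\mathbb I$. A qubit is prepared in the state $|0\rangle\langle 0|$, the observable $\sigma_k$ is measured projectively, the qubit is sent through a channel $\varepsilon$ (a completely positive trace-preserving linear map on $2\times 2$ complex matrices), and then $\sigma_l$ is measured. Let $\langle\sigma_k\sigma_l\rangle_\varepsilon$ be the expectation of the product of the two $\pm1$ outcomes; equivalently $\langle\sigma_k\sigma_l\rangle_\varepsilon=\mathrm{Tr}[(\sigma_k\otimes\sigma_l)R_{AB}]$ with $R_{AB}=(\mathcal I_A\otimes\varepsilon)\bigl(\{|0\rangle\langle 0|\otimes\tfrac{\mathbb I}{2},\mathrm{SWAP}\}\bigr)$. Let $\mathcal A\subset\mathbb R^3$ be the set of all points $p(\varepsilon)=(\langle\sigma_1\sigma_1\rangle_\varepsilon,\langle\sigma_2\sigma_2\rangle_\varepsilon,\langle\sigma_3\sigma_3\rangle_\varepsilon)$, where $\varepsilon$ runs over all channels. Let $$S=\{(\cos u,\cos v,\cos(u-v)) : u\in[0,2\pi],\ v\in[0,\pi]\}.$$ Let $\mathcal T_t$ be the convex hull of $(1,-1,-1),(1,1,1),(-1,-1,1),(-1,1,-1)$,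 and let $\mathcal T_s$ be the convex hull of $(1,1,-1),(1,-1,1),(-1,1,1),(-1,-1,-1)$; the last four points are the correlations $(\mathrm{Tr}[(\sigma_k\otimes\sigma_k)\rho])_{k=1,2,3}$ of the four Bell states. A two-qubit state is separable if it is a convex combination of product states $\alpha\otimes\beta$, and entangled otherwise. The entangled region of $\mathcal T_s$ is the set of points of $\mathcal T_s$ that are not of the form $(\mathrm{Tr}[(\sigma_k\otimes\sigma_k)\rho])_{k=1,2,3}$ for any separable $\rho$. Then: 1. $\mathcal A$ is the convex hull of $S$, and the boundary of $\mathcal A$ is exactly $S$. 2. $\mathcal T_t\subsetneq\mathcal A$. 3. $\mathcal A$ meets the entangled region of $\mathcal T_s$. 4. There are a non-unital channel $\varepsilon$ (that is, $\varepsilon(\mathbb I)\ne\mathbb I$) with $p(\varepsilon)$ in the entangled region of $\mathcal T_s$ and an entangled two-qubit state $\rho$ such that $\langle\sigma_k\sigma_l\rangle_\varepsilon=\mathrm{Tr}[(\sigma_k\otimes\sigma_l)\rho]$ for all $k,l\in\{1,2,3\}$. 5. None of the four Bell-state vertices of $\mathcal T_s$ lies in $\mathcal A$. -/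

import Mathlib

open scoped ComplexOrder Kronecker

/-- A one-qubit operator. -/
abbrev QubitOp := Matrix (Fin 2) (Fin 2) ℂ

/-- A two-qubit operator; the first factor is the system `A`, the second one the system `B`. -/
abbrev TwoQubitOp := Matrix (Fin 2 × Fin 2) (Fin 2 × Fin 2) ℂ

/-- The identity `σ₀` and the Pauli matrices `σ₁ = X`, `σ₂ = Y`, `σ₃ = Z`. -/
def pauli : Fin 4 → QubitOp :=
  ![1, !![0, 1; 1, 0], !![0, -Complex.I; Complex.I, 0], !![1, 0; 0, -1]]

/-- Density matrices: positive semidefinite matrices of trace one. -/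
def IsDensityMatrix {n : Type*} [Fintype n] (ρ : Matrix n n ℂ) : Prop :=
  ρ.PosSemidef ∧ ρ.trace = 1

/-- The pure state `|0⟩⟨0|`. -/
def ketZero : QubitOp := !![1, 0; 0, 0]

/-- The map `id ⊗ ε` on operators of (ancilla) ⊗ (qubit): `ε` is applied to every block. -/
def ampliate {ι : Type*} (ε : QubitOp →ₗ[ℂ] QubitOp) (X : Matrix (ι × Fin 2) (ι × Fin 2) ℂ) :
    Matrix (ι × Fin 2) (ι × Fin 2) ℂ :=
  Matrix.of fun p q => ε (Matrix.of fun i j => X (p.1, i) (q.1, j)) p.2 q.2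

/-- Qubit channels: completely positive trace-preserving linear maps. -/
structure IsChannel (ε : QubitOp →ₗ[ℂ] QubitOp) : Prop where
  completelyPositive : ∀ (n : ℕ) (X : Matrix (Fin n × Fin 2) (Fin n × Fin 2) ℂ),
    X.PosSemidef → (ampliate ε X).PosSemidef
  tracePreserving : ∀ X : QubitOp, (ε X).trace = X.trace

/-- A channel is unital if it fixes the identity. -/
def IsUnital (ε : QubitOp →ₗ[ℂ] QubitOp) : Prop := ε 1 = 1

/-- The sign `+1` or `-1` of a measurement outcome. -/
def outcome (a : Bool) : ℝ := if a then 1 else -1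

/-- The spectral projection `(1 ± σₖ) / 2` of the Pauli observable `σₖ`. -/
noncomputable def pauliProj (k : Fin 4) (a : Bool) : QubitOp :=
  (1 / 2 : ℂ) • (1 + (outcome a : ℂ) • pauli k)

/-- The probability of the outcomes `a`, `b` when `σₖ` is measured (projectively) on the state `ρ`,
the resulting system is sent through `ε`, and then `σₗ` is measured. -/
noncomputable def sequentialProb (ρ : QubitOp) (ε : QubitOp →ₗ[ℂ] QubitOp) (k l : Fin 4)
    (a b : Bool) : ℝ :=
  (pauliProj l b * ε (pauliProj k a * ρ * pauliProj k a)).trace.re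

/-- The two-time correlation `⟨σₖσₗ⟩`: the expectation of the product of the two outcomes. -/
noncomputable def temporalCorr (ρ : QubitOp) (ε : QubitOp →ₗ[ℂ] QubitOp) (k l : Fin 4) : ℝ :=
  ∑ a : Bool, ∑ b : Bool, outcome a * outcome b * sequentialProb ρ ε k l a b

/-- The swap operator of two qubits. -/
def swapOp : TwoQubitOp :=
  Matrix.of fun p q => if p.1 = q.2 ∧ p.2 = q.1 then 1 else 0

/-- The two-time pseudo-density matrix `R_AB = (id ⊗ ε)({ρ ⊗ I/2, SWAP})`. -/
noncomputable def temporalPDM (ρ : QubitOp) (ε : QubitOp →ₗ[ℂ] QubitOp) : TwoQubitOp :=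
  ampliate ε
    ((ρ ⊗ₖ ((1 / 2 : ℂ) • (1 : QubitOp))) * swapOp +
      swapOp * (ρ ⊗ₖ ((1 / 2 : ℂ) • (1 : QubitOp))))

/-- The two-time correlations are the Pauli components of the pseudo-density matrix. -/
theorem temporalCorr_eq_temporalPDM (ρ : QubitOp) (ε : QubitOp →ₗ[ℂ] QubitOp) (k l : Fin 4) :
    temporalCorr ρ ε k l = (((pauli k) ⊗ₖ (pauli l)) * temporalPDM ρ ε).trace.re := by
  have h1 : temporalCorr ρ ε k l =
      (pauli l * ε ((1 / 2 : ℂ) • (pauli k * ρ + ρ * pauli k))).trace.re := by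
    have key : pauli l * ε ((1 / 2 : ℂ) • (pauli k * ρ + ρ * pauli k)) =
        ∑ a : Bool, ∑ b : Bool, ((outcome a * outcome b : ℝ) : ℂ) •
          (pauliProj l b * ε (pauliProj k a * ρ * pauliProj k a)) := by
      simp only [Fintype.sum_bool, outcome, pauliProj, if_true, Bool.false_eq_true, if_false]
      simp only [add_mul, mul_add, smul_mul_assoc, mul_smul_comm, map_add, map_smul, one_mul,
        mul_one, smul_add, smul_smul]
      push_cast
      module
    rw [key]
    simp [temporalCorr, sequentialProb, Matrix.trace_add, Matrix.trace_smul]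
  have hblock : ∀ a b : Fin 2, ∀ M : TwoQubitOp,
      (Matrix.of fun i j => M (a, i) (b, j)) =
        ∑ i, ∑ j, M (a, i) (b, j) • Matrix.single i j (1 : ℂ) := by
    intro a b M
    ext i j
    fin_cases i <;> fin_cases j <;> simp [Matrix.single, Fin.sum_univ_two]
  have hρ : ((1 / 2 : ℂ) • (pauli k * ρ + ρ * pauli k)) =
        ∑ i, ∑ j, ((1 / 2 : ℂ) • (pauli k * ρ + ρ * pauli k)) i j •
          Matrix.single i j (1 : ℂ) := by
    ext i j
    fin_cases i <;> fin_cases j <;> simp [Matrix.single, Fin.sum_univ_two]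
  rw [h1, hρ]
  congr 1
  simp only [temporalPDM, ampliate, hblock, map_sum, map_smul]
  simp only [Matrix.trace, Matrix.diag, Matrix.mul_apply, Fintype.sum_prod_type, Fin.sum_univ_two,
    Matrix.kroneckerMap_apply, Matrix.of_apply, Matrix.add_apply, Matrix.smul_apply, swapOp,
    smul_eq_mul, Matrix.one_apply]
  simp
  ring

/-- The point `(⟨σ₁σ₁⟩, ⟨σ₂σ₂⟩, ⟨σ₃σ₃⟩)` of two-time correlations. -/
noncomputable def temporalPoint (ρ : QubitOp) (ε : QubitOp →ₗ[ℂ] QubitOp) : Fin 3 → ℝ :=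
  fun k => temporalCorr ρ ε k.succ k.succ

/-- The points of two-time correlations attained with input `|0⟩` and an arbitrary channel. -/
def attainableTemporal : Set (Fin 3 → ℝ) :=
  {r | ∃ ε : QubitOp →ₗ[ℂ] QubitOp, IsChannel ε ∧ r = temporalPoint ketZero ε}

/-- The surface `(cos u, cos v, cos (u - v))`, `u ∈ [0, 2π]`, `v ∈ [0, π]`. -/
noncomputable def trigSurface : Set (Fin 3 → ℝ) :=
  {r | ∃ u ∈ Set.Icc (0 : ℝ) (2 * Real.pi), ∃ v ∈ Set.Icc (0 : ℝ) Real.pi,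
    r = ![Real.cos u, Real.cos v, Real.cos (u - v)]}

/-- The temporal tetrahedron. -/
def temporalTetrahedron : Set (Fin 3 → ℝ) :=
  convexHull ℝ {![1, -1, -1], ![1, 1, 1], ![-1, -1, 1], ![-1, 1, -1]}

/-- The vertices of the spatial tetrahedron; they belong to the Bell states
`Ψ⁺`, `Φ⁺`, `Φ⁻` and `Ψ⁻`, in this order. -/
def bellVertex : Fin 4 → Fin 3 → ℝ :=
  ![![1, 1, -1], ![1, -1, 1], ![-1, 1, 1], ![-1, -1, -1]]

/-- The spatial tetrahedron. -/
def spatialTetrahedron : Set (Fin 3 → ℝ) := convexHull ℝ (Set.range bellVertex)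

/-- The correlation `⟨σₖσₗ⟩ = Tr[(σₖ ⊗ σₗ) ρ]` of a two-qubit state. -/
noncomputable def spatialCorr (ρ : TwoQubitOp) (k l : Fin 4) : ℝ :=
  (((pauli k) ⊗ₖ (pauli l)) * ρ).trace.re

/-- The point `(⟨σ₁σ₁⟩, ⟨σ₂σ₂⟩, ⟨σ₃σ₃⟩)` of a two-qubit state. -/
noncomputable def spatialPoint (ρ : TwoQubitOp) : Fin 3 → ℝ :=
  fun k => spatialCorr ρ k.succ k.succ

/-- The vectors `√2 Ψ⁺`, `√2 Φ⁺`, `√2 Φ⁻`, `√2 Ψ⁻`; the entry `(i, j)` is the coefficient of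
`|ij⟩`. -/
def bellVec : Fin 4 → QubitOp :=
  ![!![0, 1; 1, 0], !![1, 0; 0, 1], !![1, 0; 0, -1], !![0, 1; -1, 0]]

/-- The Bell states, as density matrices. -/
noncomputable def bellState (m : Fin 4) : TwoQubitOp :=
  Matrix.of fun p q => (1 / 2 : ℂ) * (bellVec m p.1 p.2 * star (bellVec m q.1 q.2))

/-- The vertices of the spatial tetrahedron are the correlations of the Bell states. -/
theorem spatialPoint_bellState (m : Fin 4) : spatialPoint (bellState m) = bellVertex m := by
  ext k
  fin_cases m <;> fin_cases k <;>
    simp [spatialPoint, spatialCorr, bellState, bellVec, bellVertex, pauli, Matrix.trace,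
      Matrix.mul_apply, Fintype.sum_prod_type, Fin.sum_univ_two] <;> norm_num

/-- Separable two-qubit states: mixtures of product states. -/
def IsSeparableState (ρ : TwoQubitOp) : Prop :=
  ρ ∈ convexHull ℝ
    {M : TwoQubitOp | ∃ α β : QubitOp, IsDensityMatrix α ∧ IsDensityMatrix β ∧ M = α ⊗ₖ β}

/-- Entangled two-qubit states: states that are not separable. -/
def IsEntangledState (ρ : TwoQubitOp) : Prop := IsDensityMatrix ρ ∧ ¬ IsSeparableState ρ

/-- The entangled region of the spatial tetrahedron: the points that no separable state attains. -/
def entangledRegion : Set (Fin 3 → ℝ) :=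
  {r | r ∈ spatialTetrahedron ∧ ¬ ∃ ρ : TwoQubitOp, IsSeparableState ρ ∧ spatialPoint ρ = r}

/-!
The attainable region is identified with the elliptope, the set of `(x, y, z)` for which the
symmetric matrix with unit diagonal and off-diagonal entries `x, y, z` is positive semidefinite;
in coordinates, `x² ≤ 1`, `y² ≤ 1` and `(z - x y)² ≤ (1 - x²) (1 - y²)`.

* A channel gives a point of the elliptope (`temporalPoint_mem_elliptope`). For the input `|0⟩` the
  correlations depend on the Choi matrix `C` of the channel only through
  `x = Re C₀₀,₁₁ + Re C₀₁,₁₀`, `y = Re C₀₀,₁₁ - Re C₀₁,₁₀` and `z = C₀₀,₀₀ - C₀₁,₀₁`.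
  Two `2 × 2` minors of `C` and trace preservation give the inequalities.
* With `x = cos u` and `y = cos v` the elliptope condition says that `z` lies between `cos (u + v)`
  and `cos (u - v)`, so each point of the elliptope lies on a vertical segment with endpoints on the
  surface (`elliptope_subset_convexHull`).
* Each point of the surface is attained by an explicit channel with two Kraus operators
  (`trigSurface_subset_attainableTemporal`), and the attainable set is convex.

The frontier of the elliptope is the locus where the last inequality is an equality, and this is the
surface. For the remaining claims, a separable state satisfies `x + y + z ≥ -1`, because its point is
a mixture of `(a₁ b₁, a₂ b₂, a₃ b₃)` with `a`, `b` in the unit ball. The same inequality holds on the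
temporal tetrahedron. The point `(-1/2, -1/2, -1/2)` of the surface, which a non-unital channel
attains and which belongs to the Werner state of weight `1/2`, violates it. The Bell vertices are not
in the elliptope, since `x² = y² = 1` there forces `z = x y`.
-/

/-! ### The elliptope and the trigonometric surface -/

/-- The elliptope of `3 × 3` correlation matrices, written through the Schur complement of the first
diagonal entry. -/
def elliptope : Set (Fin 3 → ℝ) :=
  {r | r 0 ^ 2 ≤ 1 ∧ r 1 ^ 2 ≤ 1 ∧ (r 2 - r 0 * r 1) ^ 2 ≤ (1 - r 0 ^ 2) * (1 - r 1 ^ 2)}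

theorem cos_sub_mem_trigSurface {u v : ℝ} (hu : u ∈ Set.Icc 0 Real.pi)
    (hv : v ∈ Set.Icc 0 Real.pi) :
    ![Real.cos u, Real.cos v, Real.cos (u - v)] ∈ trigSurface :=
  ⟨u, ⟨hu.1, by linarith [hu.2, Real.pi_pos]⟩, v, hv, rfl⟩

theorem cos_add_mem_trigSurface {u v : ℝ} (hu : u ∈ Set.Icc 0 Real.pi)
    (hv : v ∈ Set.Icc 0 Real.pi) :
    ![Real.cos u, Real.cos v, Real.cos (u + v)] ∈ trigSurface := by
  refine ⟨2 * Real.pi - u, ⟨by linarith [hu.2, Real.pi_pos], by linarith [hu.1]⟩, v, hv, ?_⟩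
  rw [Real.cos_two_pi_sub, show 2 * Real.pi - u - v = 2 * Real.pi - (u + v) by ring,
    Real.cos_two_pi_sub]

theorem exists_cos_eq {x : ℝ} (hx : x ^ 2 ≤ 1) : ∃ u ∈ Set.Icc 0 Real.pi, Real.cos u = x :=
  ⟨Real.arccos x, ⟨Real.arccos_nonneg x, Real.arccos_le_pi x⟩,
    Real.cos_arccos (abs_le.1 ((sq_le_one_iff_abs_le_one x).1 hx)).1
      (abs_le.1 ((sq_le_one_iff_abs_le_one x).1 hx)).2⟩

theorem mem_trigSurface_iff {r : Fin 3 → ℝ} :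
    r ∈ trigSurface ↔
      r 0 ^ 2 ≤ 1 ∧ r 1 ^ 2 ≤ 1 ∧ (r 2 - r 0 * r 1) ^ 2 = (1 - r 0 ^ 2) * (1 - r 1 ^ 2) := by
  constructor
  · rintro ⟨u, -, v, -, rfl⟩
    refine ⟨Real.cos_sq_le_one u, Real.cos_sq_le_one v, ?_⟩
    simp only [Matrix.cons_val]
    rw [Real.cos_sub, ← Real.sin_sq, ← Real.sin_sq]
    ring
  · rintro ⟨hx, hy, hz⟩
    obtain ⟨u, hu, hux⟩ := exists_cos_eq hx
    obtain ⟨v, hv, hvy⟩ := exists_cos_eq hy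
    have hr : r = ![r 0, r 1, r 2] := by ext i; fin_cases i <;> rfl
    rw [← hux, ← hvy, ← Real.sin_sq, ← Real.sin_sq, ← mul_pow, sq_eq_sq_iff_eq_or_eq_neg] at hz
    rw [hr, ← hux, ← hvy]
    rcases hz with hz | hz
    · rw [show r 2 = Real.cos (u - v) by rw [Real.cos_sub]; linarith]
      exact cos_sub_mem_trigSurface hu hv
    · rw [show r 2 = Real.cos (u + v) by rw [Real.cos_add]; linarith]
      exact cos_add_mem_trigSurface hu hv

theorem elliptope_subset_convexHull : elliptope ⊆ convexHull ℝ trigSurface := by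
  rintro r ⟨hx, hy, hz⟩
  obtain ⟨u, hu, hux⟩ := exists_cos_eq hx
  obtain ⟨v, hv, hvy⟩ := exists_cos_eq hy
  have hr : r = ![r 0, r 1, r 2] := by ext i; fin_cases i <;> rfl
  have hs : 0 ≤ Real.sin u * Real.sin v :=
    mul_nonneg (Real.sin_nonneg_of_mem_Icc hu) (Real.sin_nonneg_of_mem_Icc hv)
  rw [← hux, ← hvy, ← Real.sin_sq, ← Real.sin_sq, ← mul_pow] at hz
  have habs := abs_le.1 (abs_le_of_sq_le_sq hz hs)
  have hmem : r 2 ∈ segment ℝ (Real.cos (u + v)) (Real.cos (u - v)) := by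
    rw [segment_eq_Icc (by rw [Real.cos_add, Real.cos_sub]; linarith), Real.cos_add, Real.cos_sub]
    exact ⟨by linarith [habs.1], by linarith [habs.2]⟩
  obtain ⟨a, b, ha, hb, hab, h⟩ := hmem
  have hconv := convex_convexHull ℝ trigSurface
    (subset_convexHull ℝ _ (cos_add_mem_trigSurface hu hv))
    (subset_convexHull ℝ _ (cos_sub_mem_trigSurface hu hv)) ha hb hab
  convert hconv using 1
  rw [hr, ← hux, ← hvy, ← h]
  ext i
  fin_cases i <;> simp [← add_mul, hab]

theorem isClosed_elliptope : IsClosed elliptope := by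
  have h0 : IsClosed {r : Fin 3 → ℝ | r 0 ^ 2 ≤ 1} := isClosed_le (by fun_prop) (by fun_prop)
  have h1 : IsClosed {r : Fin 3 → ℝ | r 1 ^ 2 ≤ 1} := isClosed_le (by fun_prop) (by fun_prop)
  have h2 : IsClosed {r : Fin 3 → ℝ | (r 2 - r 0 * r 1) ^ 2 ≤ (1 - r 0 ^ 2) * (1 - r 1 ^ 2)} :=
    isClosed_le (by fun_prop) (by fun_prop)
  exact h0.inter (h1.inter h2)

theorem frontier_elliptope : frontier elliptope = trigSurface := by
  rw [isClosed_elliptope.frontier_eq]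
  ext r
  rw [mem_trigSurface_iff]
  constructor
  · rintro ⟨⟨hx, hy, hz⟩, hint⟩
    refine ⟨hx, hy, hz.antisymm (not_lt.1 fun hlt => hint ?_)⟩
    have hopen : IsOpen {s : Fin 3 → ℝ | s 0 ^ 2 < 1 ∧ s 1 ^ 2 < 1 ∧
        (s 2 - s 0 * s 1) ^ 2 < (1 - s 0 ^ 2) * (1 - s 1 ^ 2)} := by
      have h0 : IsOpen {s : Fin 3 → ℝ | s 0 ^ 2 < 1} := isOpen_lt (by fun_prop) (by fun_prop)
      have h1 : IsOpen {s : Fin 3 → ℝ | s 1 ^ 2 < 1} := isOpen_lt (by fun_prop) (by fun_prop)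
      have h2 : IsOpen {s : Fin 3 → ℝ |
          (s 2 - s 0 * s 1) ^ 2 < (1 - s 0 ^ 2) * (1 - s 1 ^ 2)} :=
        isOpen_lt (by fun_prop) (by fun_prop)
      exact h0.inter (h1.inter h2)
    -- A strict last inequality forces the two others to be strict.
    have hpos : 0 < (1 - r 0 ^ 2) * (1 - r 1 ^ 2) := (sq_nonneg _).trans_lt hlt
    refine mem_interior.2 ⟨_, fun s hs => ⟨hs.1.le, hs.2.1.le, hs.2.2.le⟩, hopen, ?_, ?_, hlt⟩
    · exact hx.lt_of_ne fun h => by simp [h] at hpos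
    · exact hy.lt_of_ne fun h => by simp [h] at hpos
  · rintro ⟨hx, hy, hz⟩
    refine ⟨⟨hx, hy, hz.le⟩, fun hint => ?_⟩
    -- Moving `z` away from `x y` leaves the elliptope at once.
    set w := r 2 - r 0 * r 1 with hw
    let σ : ℝ := if 0 ≤ w then 1 else -1
    let f : ℝ → Fin 3 → ℝ := fun t => ![r 0, r 1, r 2 + σ * t]
    have hf : Continuous f := by
      refine continuous_pi fun i => ?_
      fin_cases i
      · exact continuous_const
      · exact continuous_const
      · exact continuous_const.add (continuous_const.mul continuous_id)
    have hf0 : f 0 = r := by ext i; fin_cases i <;> simp [f]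
    have hev : ∀ᶠ t in nhds (0 : ℝ), f t ∈ interior elliptope :=
      hf.continuousAt.eventually_mem (by rw [hf0]; exact isOpen_interior.mem_nhds hint)
    obtain ⟨t, ht, hpos⟩ :=
      ((hev.filter_mono nhdsWithin_le_nhds).and (self_mem_nhdsWithin (s := Set.Ioi (0 : ℝ)))).exists
    have hle : (r 2 + σ * t - r 0 * r 1) ^ 2 ≤ (1 - r 0 ^ 2) * (1 - r 1 ^ 2) :=
      (interior_subset ht).2.2
    rw [← hz, show r 2 + σ * t - r 0 * r 1 = w + σ * t by rw [hw]; ring] at hle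
    have ht0 : 0 < t := hpos
    by_cases h : 0 ≤ w
    · have : σ = 1 := if_pos h
      rw [this] at hle
      nlinarith
    · have : σ = -1 := if_neg h
      rw [this] at hle
      nlinarith

/-! ### Correlations of a channel and its Choi matrix -/

/-- Only the anticommutator of the observable with the input state enters the two-time
correlation. -/
theorem temporalCorr_eq_trace (ρ : QubitOp) (ε : QubitOp →ₗ[ℂ] QubitOp) (k l : Fin 4) :
    temporalCorr ρ ε k l = (pauli l * ε ((1 / 2 : ℂ) • (pauli k * ρ + ρ * pauli k))).trace.re := by
  have key : pauli l * ε ((1 / 2 : ℂ) • (pauli k * ρ + ρ * pauli k)) =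
      ∑ a : Bool, ∑ b : Bool, ((outcome a * outcome b : ℝ) : ℂ) •
        (pauliProj l b * ε (pauliProj k a * ρ * pauliProj k a)) := by
    simp only [Fintype.sum_bool, outcome, pauliProj, if_true, Bool.false_eq_true, if_false]
    simp only [add_mul, mul_add, smul_mul_assoc, mul_smul_comm, map_add, map_smul, one_mul,
      mul_one, smul_add, smul_smul]
    push_cast
    module
  rw [key]
  simp [temporalCorr, sequentialProb, Matrix.trace_add, Matrix.trace_smul]

/-- The operator `½ {σₖ, |0⟩⟨0|}` for `k = 1, 2, 3`: it is `σ₁ / 2`, `σ₂ / 2` and `|0⟩⟨0|`. -/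
theorem half_anticommutator_ketZero (k : Fin 3) :
    (1 / 2 : ℂ) • (pauli k.succ * ketZero + ketZero * pauli k.succ) =
      (![!![0, 1 / 2; 1 / 2, 0], !![0, -Complex.I / 2; Complex.I / 2, 0], !![1, 0; 0, 0]] :
        Fin 3 → QubitOp) k := by
  fin_cases k <;> ext i j <;> fin_cases i <;> fin_cases j <;>
    simp [pauli, ketZero] <;> ring

/-- The Choi matrix `∑ |i⟩⟨j| ⊗ ε(|i⟩⟨j|)` of a map on one-qubit operators. -/
def choi (ε : QubitOp →ₗ[ℂ] QubitOp) : TwoQubitOp :=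
  Matrix.of fun p q => ε (Matrix.single p.1 q.1 1) p.2 q.2

theorem IsChannel.posSemidef_choi {ε : QubitOp →ₗ[ℂ] QubitOp} (hε : IsChannel ε) :
    (choi ε).PosSemidef := by
  -- The Choi matrix is the image of the unnormalised maximally entangled state.
  let ω : Fin 2 × Fin 2 → ℂ := fun p => if p.1 = p.2 then 1 else 0
  have h := hε.completelyPositive 2 _ (Matrix.posSemidef_vecMulVec_self_star ω)
  convert h using 1
  ext p q
  simp only [choi, ampliate, Matrix.of_apply]
  refine congrFun (congrFun (congrArg ε ?_) p.2) q.2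
  ext i j
  simp [Matrix.single, Matrix.vecMulVec, ω, ← ite_and, and_comm]

theorem apply_eq_choi (ε : QubitOp →ₗ[ℂ] QubitOp) (X : QubitOp) (a b : Fin 2) :
    ε X a b = ∑ i, ∑ j, X i j * choi ε (i, a) (j, b) := by
  conv_lhs => rw [Matrix.matrix_eq_sum_single X]
  simp only [map_sum, Matrix.sum_apply]
  refine Finset.sum_congr rfl fun i _ => Finset.sum_congr rfl fun j _ => ?_
  rw [show Matrix.single i j (X i j) = X i j • Matrix.single i j (1 : ℂ) by
    simp [Matrix.smul_single], map_smul]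
  rfl

/-- A `2 × 2` principal minor of a positive semidefinite matrix is nonnegative. -/
theorem Matrix.PosSemidef.re_sq_le {n : Type*} [Fintype n] [DecidableEq n] {M : Matrix n n ℂ}
    (hM : M.PosSemidef) (i j : n) : (M i j).re ^ 2 + (M i j).im ^ 2 ≤ (M i i).re * (M j j).re := by
  have hdet := (hM.submatrix ![i, j]).det_nonneg
  have hd : ∀ k, (M k k).im = 0 := fun k => (Complex.nonneg_iff.1 (hM.diag_nonneg (i := k))).2.symm
  have hji : M j i = star (M i j) := (hM.isHermitian.apply j i).symm
  rw [Matrix.det_fin_two] at hdet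
  have h := (Complex.nonneg_iff.1 hdet).1
  simp [hji, hd] at h
  nlinarith

/-- The elliptope inequalities from the two minors `|C₀₀,₁₁|² ≤ a d` and
`|C₀₁,₁₀|² ≤ (1 - a) (1 - d)`, where `a = C₀₀,₀₀` and `d = C₁₁,₁₁`. -/
theorem elliptope_of_minors {a d α β : ℝ} (ha : 0 ≤ a) (ha' : a ≤ 1) (hd : 0 ≤ d) (hd' : d ≤ 1)
    (hα : α ^ 2 ≤ a * d) (hβ : β ^ 2 ≤ (1 - a) * (1 - d)) :
    (α + β) ^ 2 ≤ 1 ∧ (α - β) ^ 2 ≤ 1 ∧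
      (a - (1 - a) - (α + β) * (α - β)) ^ 2 ≤ (1 - (α + β) ^ 2) * (1 - (α - β) ^ 2) := by
  have ha'' := sub_nonneg.2 ha'
  have hd'' := sub_nonneg.2 hd'
  -- The arithmetic-geometric mean inequality for `a (1 - d)` and `d (1 - a)`.
  have hsq : (2 * (α * β)) ^ 2 ≤ (a * (1 - d) + d * (1 - a)) ^ 2 := by
    have := mul_le_mul hα hβ (sq_nonneg β) (mul_nonneg ha hd)
    nlinarith [sq_nonneg (a * (1 - d) - d * (1 - a))]
  have habs := abs_le.1 (abs_le_of_sq_le_sq hsq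
    (add_nonneg (mul_nonneg ha hd'') (mul_nonneg hd ha'')))
  refine ⟨by nlinarith [habs.2], by nlinarith [habs.1], ?_⟩
  have h1 := mul_le_mul_of_nonneg_left hα ha''
  have h2 := mul_le_mul_of_nonneg_left hβ ha
  nlinarith

theorem temporalPoint_mem_elliptope {ε : QubitOp →ₗ[ℂ] QubitOp} (hε : IsChannel ε) :
    temporalPoint ketZero ε ∈ elliptope := by
  have hC := hε.posSemidef_choi
  set C := choi ε with hCdef
  have hre : ∀ p q, (C p q).re = (C q p).re := fun p q => by
    rw [← hC.isHermitian.apply p q]; simp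
  have hdiag : ∀ p, 0 ≤ (C p p).re := fun p => (Complex.nonneg_iff.1 (hC.diag_nonneg (i := p))).1
  have htr : ∀ i, (C (i, 0) (i, 0)).re + (C (i, 1) (i, 1)).re = 1 := fun i => by
    have := congrArg Complex.re (hε.tracePreserving (Matrix.single i i 1))
    simpa [Matrix.trace_fin_two, hCdef, choi] using this
  have e0 : temporalPoint ketZero ε 0 = (C (0, 0) (1, 1)).re + (C (0, 1) (1, 0)).re := by
    simp only [temporalPoint, temporalCorr_eq_trace, half_anticommutator_ketZero]
    simp only [Matrix.trace_fin_two, Matrix.mul_apply, apply_eq_choi, Fin.sum_univ_two, ← hCdef]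
    simp [pauli, hre (1, 0) (0, 1), hre (1, 1) (0, 0)]
    ring
  have e1 : temporalPoint ketZero ε 1 = (C (0, 0) (1, 1)).re - (C (0, 1) (1, 0)).re := by
    simp only [temporalPoint, temporalCorr_eq_trace, half_anticommutator_ketZero]
    simp only [Matrix.trace_fin_two, Matrix.mul_apply, apply_eq_choi, Fin.sum_univ_two, ← hCdef]
    simp [pauli, hre (1, 0) (0, 1), hre (1, 1) (0, 0)]
    ring
  have e2 : temporalPoint ketZero ε 2 = (C (0, 0) (0, 0)).re - (C (0, 1) (0, 1)).re := by
    simp only [temporalPoint, temporalCorr_eq_trace, half_anticommutator_ketZero]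
    simp only [Matrix.trace_fin_two, Matrix.mul_apply, apply_eq_choi, Fin.sum_univ_two, ← hCdef]
    simp [pauli]
    ring
  simp only [elliptope, Set.mem_ofPred_eq, e0, e1, e2]
  rw [show (C (0, 1) (0, 1)).re = 1 - (C (0, 0) (0, 0)).re by linarith [htr 0]]
  apply elliptope_of_minors (hdiag _) (by linarith [htr 0, hdiag (0, 1)]) (hdiag (1, 1))
    (by linarith [htr 1, hdiag (1, 0)])
  · nlinarith [hC.re_sq_le (0, 0) (1, 1)]
  · rw [show 1 - (C (0, 0) (0, 0)).re = (C (0, 1) (0, 1)).re by linarith [htr 0],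
      show 1 - (C (1, 1) (1, 1)).re = (C (1, 0) (1, 0)).re by linarith [htr 1]]
    nlinarith [hC.re_sq_le (0, 1) (1, 0)]

/-! ### Channels attaining the surface -/

theorem ampliate_add {ι : Type*} (ε δ : QubitOp →ₗ[ℂ] QubitOp)
    (X : Matrix (ι × Fin 2) (ι × Fin 2) ℂ) :
    ampliate (ε + δ) X = ampliate ε X + ampliate δ X := rfl

theorem ampliate_smul {ι : Type*} (c : ℝ) (ε : QubitOp →ₗ[ℂ] QubitOp)
    (X : Matrix (ι × Fin 2) (ι × Fin 2) ℂ) :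
    ampliate (c • ε) X = c • ampliate ε X := rfl

theorem IsChannel.convexCombination {ε δ : QubitOp →ₗ[ℂ] QubitOp} (hε : IsChannel ε)
    (hδ : IsChannel δ) {a b : ℝ} (ha : 0 ≤ a) (hb : 0 ≤ b) (hab : a + b = 1) :
    IsChannel (a • ε + b • δ) where
  completelyPositive n X hX := by
    rw [ampliate_add, ampliate_smul, ampliate_smul]
    exact ((hε.completelyPositive n X hX).smul ha).add ((hδ.completelyPositive n X hX).smul hb)
  tracePreserving X := by
    simp only [LinearMap.add_apply, LinearMap.smul_apply, Matrix.trace_add, Matrix.trace_smul,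
      hε.tracePreserving, hδ.tracePreserving, ← add_smul, hab, one_smul]

theorem convex_attainableTemporal : Convex ℝ attainableTemporal := by
  rintro _ ⟨ε, hε, rfl⟩ _ ⟨δ, hδ, rfl⟩ a b ha hb hab
  refine ⟨a • ε + b • δ, hε.convexCombination hδ ha hb hab, ?_⟩
  ext k
  simp only [temporalPoint, temporalCorr_eq_trace, Pi.add_apply, Pi.smul_apply,
    LinearMap.add_apply, LinearMap.smul_apply, mul_add, Matrix.mul_smul, Matrix.trace_add,
    Matrix.trace_smul, Complex.add_re, Complex.smul_re]

/-- The map `X ↦ K X K†` of a single Kraus operator. -/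
def krausMap (K : QubitOp) : QubitOp →ₗ[ℂ] QubitOp where
  toFun X := K * X * K.conjTranspose
  map_add' X Y := by rw [mul_add, add_mul]
  map_smul' c X := by simp

theorem krausMap_apply (K X : QubitOp) : krausMap K X = K * X * K.conjTranspose := rfl

theorem ampliate_krausMap {n : ℕ} (K : QubitOp) (X : Matrix (Fin n × Fin 2) (Fin n × Fin 2) ℂ) :
    ampliate (krausMap K) X =
      ((1 : Matrix (Fin n) (Fin n) ℂ) ⊗ₖ K) * X *
        ((1 : Matrix (Fin n) (Fin n) ℂ) ⊗ₖ K).conjTranspose := by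
  ext p q
  simp [ampliate, krausMap_apply, Matrix.mul_apply, Fintype.sum_prod_type, Matrix.one_apply,
    Fin.sum_univ_two, apply_ite (starRingEnd ℂ)]

theorem isChannel_krausMap_add {K L : QubitOp}
    (h : K.conjTranspose * K + L.conjTranspose * L = 1) :
    IsChannel (krausMap K + krausMap L) where
  completelyPositive n X hX := by
    rw [ampliate_add, ampliate_krausMap, ampliate_krausMap]
    exact (hX.mul_mul_conjTranspose_same _).add (hX.mul_mul_conjTranspose_same _)
  tracePreserving X := by
    rw [LinearMap.add_apply, krausMap_apply, krausMap_apply, Matrix.trace_add,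
      Matrix.trace_mul_cycle, Matrix.trace_mul_cycle L, ← Matrix.trace_add, ← add_mul, h, one_mul]

/-- The channel with Kraus operators `diag (cos s, cos t)` and `sin s |1⟩⟨0| - sin t |0⟩⟨1|`. -/
noncomputable def surfaceChannel (s t : ℝ) : QubitOp →ₗ[ℂ] QubitOp :=
  krausMap !![(Real.cos s : ℂ), 0; 0, (Real.cos t : ℂ)] +
    krausMap !![0, -(Real.sin t : ℂ); (Real.sin s : ℂ), 0]

theorem surfaceChannel_apply (s t : ℝ) (X : QubitOp) :
    surfaceChannel s t X =
      !![(Real.cos s ^ 2 : ℂ) * X 0 0 + (Real.sin t ^ 2 : ℂ) * X 1 1,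
        (Real.cos s * Real.cos t : ℂ) * X 0 1 - (Real.sin s * Real.sin t : ℂ) * X 1 0;
        (Real.cos s * Real.cos t : ℂ) * X 1 0 - (Real.sin s * Real.sin t : ℂ) * X 0 1,
        (Real.sin s ^ 2 : ℂ) * X 0 0 + (Real.cos t ^ 2 : ℂ) * X 1 1] := by
  ext i j
  simp only [surfaceChannel, LinearMap.add_apply, krausMap_apply, Matrix.add_apply,
    Matrix.mul_apply, Fin.sum_univ_two, Matrix.conjTranspose_apply]
  fin_cases i <;> fin_cases j <;>
    simp [← Complex.cos_conj, ← Complex.sin_conj] <;> ring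

theorem isChannel_surfaceChannel (s t : ℝ) : IsChannel (surfaceChannel s t) := by
  apply isChannel_krausMap_add
  ext i j
  fin_cases i <;> fin_cases j <;>
    simp [Matrix.mul_apply, Fin.sum_univ_two, ← Complex.cos_conj, ← Complex.sin_conj, ← pow_two]

theorem temporalCorr_surfaceChannel (s t : ℝ) (k l : Fin 3) :
    temporalCorr ketZero (surfaceChannel s t) k.succ l.succ =
      Matrix.diagonal ![Real.cos (s + t), Real.cos (s - t), Real.cos (2 * s)] k l := by
  rw [temporalCorr_eq_trace, half_anticommutator_ketZero, surfaceChannel_apply]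
  fin_cases k <;> fin_cases l <;>
    simp [pauli, Matrix.trace_fin_two, Real.cos_add, Real.cos_sub, Real.cos_two_mul',
      -Complex.ofReal_cos, -Complex.ofReal_sin, ← Complex.ofReal_pow] <;> ring

theorem temporalPoint_surfaceChannel (s t : ℝ) :
    temporalPoint ketZero (surfaceChannel s t) =
      ![Real.cos (s + t), Real.cos (s - t), Real.cos (2 * s)] := by
  ext k
  rw [temporalPoint, temporalCorr_surfaceChannel, Matrix.diagonal_apply_eq]

theorem trigSurface_subset_attainableTemporal : trigSurface ⊆ attainableTemporal := by
  rintro _ ⟨u, -, v, -, rfl⟩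
  refine ⟨surfaceChannel ((u - v) / 2) ((u + v) / 2), isChannel_surfaceChannel _ _, ?_⟩
  rw [temporalPoint_surfaceChannel, show (u - v) / 2 + (u + v) / 2 = u by ring,
    show (u - v) / 2 - (u + v) / 2 = -v by ring, Real.cos_neg,
    show 2 * ((u - v) / 2) = u - v by ring]

theorem attainableTemporal_eq_convexHull : attainableTemporal = convexHull ℝ trigSurface := by
  refine Set.Subset.antisymm ?_
    (convexHull_min trigSurface_subset_attainableTemporal convex_attainableTemporal)
  rintro _ ⟨ε, hε, rfl⟩
  exact elliptope_subset_convexHull (temporalPoint_mem_elliptope hε)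

theorem attainableTemporal_eq_elliptope : attainableTemporal = elliptope := by
  refine Set.Subset.antisymm ?_
    (attainableTemporal_eq_convexHull ▸ elliptope_subset_convexHull)
  rintro _ ⟨ε, hε, rfl⟩
  exact temporalPoint_mem_elliptope hε

/-! ### Separable states and the Werner state -/

/-- The Bloch vector `(Tr[σ₁ α], Tr[σ₂ α], Tr[σ₃ α])` of a one-qubit operator. -/
noncomputable def blochVector (α : QubitOp) : Fin 3 → ℝ := fun k => (pauli k.succ * α).trace.re

theorem IsDensityMatrix.sum_sq_blochVector_le {α : QubitOp} (h : IsDensityMatrix α) :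
    ∑ k, blochVector α k ^ 2 ≤ 1 := by
  have hm := h.1.re_sq_le 0 1
  have ht := congrArg Complex.re h.2
  have h10 : α 1 0 = star (α 0 1) := (h.1.isHermitian.apply 1 0).symm
  simp [Matrix.trace_fin_two] at ht
  simp [blochVector, pauli, Fin.sum_univ_three, Matrix.trace_fin_two, Matrix.mul_apply,
    Fin.sum_univ_two, h10]
  nlinarith

theorem spatialPoint_kronecker {α β : QubitOp} (hα : IsDensityMatrix α) (hβ : IsDensityMatrix β)
    (k : Fin 3) : spatialPoint (α ⊗ₖ β) k = blochVector α k * blochVector β k := by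
  have him : ∀ {γ : QubitOp}, IsDensityMatrix γ → (pauli k.succ * γ).trace.im = 0 := by
    intro γ hγ
    have h10 : γ 1 0 = star (γ 0 1) := (hγ.1.isHermitian.apply 1 0).symm
    have hd : ∀ i, (γ i i).im = 0 :=
      fun i => (Complex.nonneg_iff.1 (hγ.1.diag_nonneg (i := i))).2.symm
    simp only [Matrix.trace_fin_two, Matrix.mul_apply, Fin.sum_univ_two]
    fin_cases k <;> simp [pauli, h10, hd]
  simp only [spatialPoint, spatialCorr, blochVector]
  rw [← Matrix.mul_kronecker_mul, Matrix.trace_kronecker, Complex.mul_re, him hα, him hβ]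
  simp

theorem IsSeparableState.neg_one_le_sum {ρ : TwoQubitOp} (hρ : IsSeparableState ρ) :
    -1 ≤ ∑ k, spatialPoint ρ k := by
  have hconv : Convex ℝ {M : TwoQubitOp | -1 ≤ ∑ k, spatialPoint M k} := by
    intro M hM N hN a b ha hb hab
    have hlin : ∑ k, spatialPoint (a • M + b • N) k =
        a * ∑ k, spatialPoint M k + b * ∑ k, spatialPoint N k := by
      simp only [spatialPoint, spatialCorr, mul_add, Matrix.mul_smul, Matrix.trace_add,
        Matrix.trace_smul, Complex.add_re, Complex.smul_re, smul_eq_mul, Finset.sum_add_distrib,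
        Finset.mul_sum]
    simp only [Set.mem_ofPred_eq] at hM hN ⊢
    rw [hlin]
    nlinarith
  refine convexHull_min ?_ hconv hρ
  rintro _ ⟨α, β, hα, hβ, rfl⟩
  have ha := hα.sum_sq_blochVector_le
  have hb := hβ.sum_sq_blochVector_le
  simp only [Set.mem_ofPred_eq, spatialPoint_kronecker hα hβ]
  -- `-2 a · b ≤ |a|² + |b|² ≤ 2`.
  have hsq : 0 ≤ ∑ k, (blochVector α k + blochVector β k) ^ 2 :=
    Finset.sum_nonneg fun _ _ => sq_nonneg _
  simp only [Fin.sum_univ_three] at *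
  nlinarith

/-- The Werner state with weight `1 / 2` on the singlet. -/
noncomputable def wernerState : TwoQubitOp :=
  (1 / 2 : ℝ) • bellState 3 + (1 / 8 : ℝ) • (1 : TwoQubitOp)

theorem isDensityMatrix_wernerState : IsDensityMatrix wernerState := by
  constructor
  · have hbell : (bellState 3).PosSemidef := by
      have h : bellState 3 = (1 / 2 : ℝ) • Matrix.vecMulVec (fun p => bellVec 3 p.1 p.2)
          (star fun p => bellVec 3 p.1 p.2) := by
        ext p q
        simp [bellState, Matrix.vecMulVec]
      rw [h]
      exact (Matrix.posSemidef_vecMulVec_self_star _).smul (by norm_num)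
    exact (hbell.smul (by norm_num)).add (Matrix.PosSemidef.one.smul (by norm_num))
  · simp [wernerState, bellState, bellVec, Matrix.trace, Fintype.sum_prod_type, Fin.sum_univ_two]
    norm_num

theorem spatialCorr_wernerState (k l : Fin 3) :
    spatialCorr wernerState k.succ l.succ = Matrix.diagonal (fun _ => (-1 / 2 : ℝ)) k l := by
  fin_cases k <;> fin_cases l <;>
    simp [spatialCorr, wernerState, bellState, bellVec, pauli, Matrix.trace, Matrix.mul_apply,
      Fintype.sum_prod_type, Fin.sum_univ_two, Matrix.one_apply] <;> norm_num

/-- The point of the Werner state lies beyond the bound `x + y + z ≥ -1` of the separable states, in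
the corner of the spatial tetrahedron at the singlet. -/
theorem werner_mem_entangledRegion : (fun _ => -1 / 2 : Fin 3 → ℝ) ∈ entangledRegion := by
  constructor
  · have hmem : ∀ m, bellVertex m ∈ spatialTetrahedron :=
      fun m => subset_convexHull ℝ _ (Set.mem_range_self m)
    have h := (convex_convexHull ℝ (Set.range bellVertex)).sum_mem (t := Finset.univ)
      (w := ![1 / 8, 1 / 8, 1 / 8, 5 / 8]) (z := bellVertex)
      (fun m _ => by fin_cases m <;> norm_num) (by simp [Fin.sum_univ_four]; norm_num)
      (fun m _ => hmem m)
    have hw : (fun _ => -1 / 2 : Fin 3 → ℝ) =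
        ∑ m, (![1 / 8, 1 / 8, 1 / 8, 5 / 8] : Fin 4 → ℝ) m • bellVertex m := by
      ext k
      fin_cases k <;> simp [Fin.sum_univ_four, bellVertex] <;> norm_num
    exact hw ▸ h
  · rintro ⟨ρ, hρ, h⟩
    have := hρ.neg_one_le_sum
    rw [h] at this
    norm_num [Fin.sum_univ_three] at this

theorem isEntangledState_wernerState : IsEntangledState wernerState := by
  refine ⟨isDensityMatrix_wernerState, fun h => werner_mem_entangledRegion.2 ⟨_, h, ?_⟩⟩
  ext k
  rw [spatialPoint, spatialCorr_wernerState, Matrix.diagonal_apply_eq]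

theorem cos_two_pi_div_three : Real.cos (2 * (Real.pi / 3)) = -1 / 2 := by
  rw [Real.cos_two_mul, Real.cos_pi_div_three]
  norm_num

/-- At `s = π / 3`, `t = π` the channel of the surface is an amplitude damping channel towards `|1⟩`
followed by a phase flip, and its correlations are those of the Werner state. -/
theorem temporalCorr_dampingChannel (k l : Fin 3) :
    temporalCorr ketZero (surfaceChannel (Real.pi / 3) Real.pi) k.succ l.succ =
      Matrix.diagonal (fun _ => (-1 / 2 : ℝ)) k l := by
  rw [temporalCorr_surfaceChannel, Real.cos_add_pi, Real.cos_sub_pi, cos_two_pi_div_three,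
    Real.cos_pi_div_three]
  congr 2
  ext i
  fin_cases i <;> norm_num

theorem temporalPoint_dampingChannel :
    temporalPoint ketZero (surfaceChannel (Real.pi / 3) Real.pi) = fun _ => -1 / 2 := by
  ext k
  rw [temporalPoint, temporalCorr_dampingChannel, Matrix.diagonal_apply_eq]

theorem not_isUnital_dampingChannel : ¬ IsUnital (surfaceChannel (Real.pi / 3) Real.pi) := by
  intro h
  have h00 := congrArg Complex.re (congrFun (congrFun h 0) 0)
  rw [surfaceChannel_apply, Real.cos_pi_div_three] at h00
  norm_num at h00

theorem temporalTetrahedron_ssubset : temporalTetrahedron ⊂ attainableTemporal := by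
  refine (Set.ssubset_iff_of_subset (convexHull_min ?_ convex_attainableTemporal)).2
    ⟨fun _ => -1 / 2, ?_, fun h => ?_⟩
  · rw [attainableTemporal_eq_elliptope]
    rintro r (rfl | rfl | rfl | rfl) <;> simp [elliptope]
  · exact ⟨_, isChannel_surfaceChannel _ _, temporalPoint_dampingChannel.symm⟩
  · -- The plane `x + y + z = -1` carries a facet of the temporal tetrahedron.
    have hconv : Convex ℝ {r : Fin 3 → ℝ | -1 ≤ ∑ k, r k} := by
      intro p hp q hq a b ha hb hab
      simp only [Set.mem_ofPred_eq, Fin.sum_univ_three, Pi.add_apply, Pi.smul_apply,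
        smul_eq_mul] at *
      nlinarith
    have hle : (fun _ => -1 / 2 : Fin 3 → ℝ) ∈ {r : Fin 3 → ℝ | -1 ≤ ∑ k, r k} := by
      refine convexHull_min ?_ hconv h
      rintro r (rfl | rfl | rfl | rfl) <;> (simp [Fin.sum_univ_three]; try norm_num)
    norm_num [Fin.sum_univ_three] at hle

theorem bellVertex_notMem_elliptope (m : Fin 4) : bellVertex m ∉ elliptope := by
  fin_cases m <;> simp [elliptope, bellVertex] <;> norm_num

theorem mainTheorem5 :
    attainableTemporal = convexHull ℝ trigSurface ∧
    frontier attainableTemporal = trigSurface ∧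
    temporalTetrahedron ⊂ attainableTemporal ∧
    (attainableTemporal ∩ entangledRegion).Nonempty ∧
    (∃ ε : QubitOp →ₗ[ℂ] QubitOp, IsChannel ε ∧ ¬ IsUnital ε ∧
      temporalPoint ketZero ε ∈ entangledRegion ∧
      ∃ ρ : TwoQubitOp, IsEntangledState ρ ∧
        ∀ k l : Fin 3, temporalCorr ketZero ε k.succ l.succ = spatialCorr ρ k.succ l.succ) ∧
    (∀ m : Fin 4, bellVertex m ∉ attainableTemporal) := by
  have hε := isChannel_surfaceChannel (Real.pi / 3) Real.pi
  have hp : temporalPoint ketZero (surfaceChannel (Real.pi / 3) Real.pi) ∈ entangledRegion :=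
    temporalPoint_dampingChannel ▸ werner_mem_entangledRegion
  refine ⟨attainableTemporal_eq_convexHull, ?_, temporalTetrahedron_ssubset,
    ⟨_, ⟨_, hε, rfl⟩, hp⟩, ⟨_, hε, not_isUnital_dampingChannel, hp, wernerState,
      isEntangledState_wernerState, fun k l => ?_⟩, fun m => ?_⟩
  · rw [attainableTemporal_eq_elliptope, frontier_elliptope]
  · rw [temporalCorr_dampingChannel, spatialCorr_wernerState]
  · rw [attainableTemporal_eq_elliptope]
    exact bellVertex_notMem_elliptope m
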